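/- **Setting.** Consider a linear program $$\max\{c^{\top}x : Ax=b,\ Dx\le d,\ x\in\mathbb R^n\}\qquad(\mathrm{LP})$$ with real (in particular, integral) data, where $A$ has full row rank, the system $Dx\le d$ contains the inequalities $x\ge 0$, and the feasible region $P$ is a $0/1$ polytope (bounded, with all extreme points in $\{0,1\}^n$). Adding a slack variable to each inequality other than $x\ge0$ gives the standard equality form $\max\{c'^{\top}x': A'x'=b',\ x'\ge 0\}$, on whose feasible bases the Simplex method works. For a feasible basis $B$ with set $N$ of nonbasic variables: * its vertex is the basic solution restricted to the $n$ original variables; $B$ is an optimal basis if all its reduced costs are $\le 0$; * the pivot direction $z^j\in\mathbb R^n$ of $j\in N$ is the restriction to the original variables of the vector $z'$ with $z'(j)=1$, $z'(B)=-A_B'^{-1}A'_j$, and $z'=0$ at the other nonbasic variables; * the basic cone $\mathcal C(B)$ is the set of $z\in\mathbb R^n$ with $Az=0$ that satisfy the homogeneous versions of the inequalities belonging to the nonbasic variables (the inequality $x_i\ge0$ for an original variable, a row of $Dx\le d$ for a slack variable); it is generated by the $z^j$, $j\in N$; * the pivot with entering variable $j$ is non-degenerate if one can move from the vertex of $B$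 a positive distance in direction $z^j$ inside $P$, and degenerate otherwise. **The Slim Shadow pivot rule.** Let $B^0$ be any (ordered) feasible basis, $x^0$ its vertex, and $v=\mathbf 1-2x^0$; $v$ stays fixed. The method stops at an optimal basis. At a non-optimal basis $B$ the entering variable $j\in N$ is chosen as follows, arbitrarily if there are several candidates. * *Main phase.* If every $z\in\mathcal C(B)$ with $c^{\top}z>0$ has $v^{\top}z>0$, then $j$ maximizes $\dfrac{c^{\top}z^j}{v^{\top}z^j}$ over the improving pivot directions (those with $c^{\top}z^j>0$). * *Initial phase.* Otherwise $j$ is such that either $c^{\top}z^j>0$ and $v^{\top}z^j\le0$, or $v^{\top}z^j<0$. The leaving variable is chosen by the lexicographic rule: with $u=A_B'^{-1}A'_j$, the position $\ell$ leaves for which, among the positions $i$ with $u(i)>0$, the vector $\bigl((A_B'^{-1}b')(i),\ \text{row } i \text{ of } A_B'^{-1}A'_{B^0}\bigr)/u(i)$ is lexicographically smallest. **Theorem.** On any such $0/1$-LP with $n$ variables and from any initial feasible basis $B^0$, the Simplex method with the Slim Shadow pivot rule reaches an optimal solution by performing no more than $n$ non-degenerate pivots. More precisely, whatever choices are made among the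 admissible entering variables: all bases visited are feasible; the number of pivots is bounded (the method does not cycle); an execution that cannot be continued has reached an optimal basis whose vertex is an optimal solution of (LP); all pivots of the initial phase are degenerate; and at most $n$ pivots of an execution are non-degenerate. -/

import Mathlib

open Matrix

noncomputable section

/-- A linear program `max {cᵀx : Ax = b, Dx ≤ d, x ∈ ℝⁿ}` whose system `Dx ≤ d` of inequalities
contains the inequalities `x ≥ 0`: row `nn i` of `Dx ≤ d` reads `-x i ≤ 0`. -/
structure LinProg (m p n : ℕ) where
  A : Matrix (Fin m) (Fin n) ℝ
  b : Fin m → ℝ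
  D : Matrix (Fin p) (Fin n) ℝ
  d : Fin p → ℝ
  c : Fin n → ℝ
  nn : Fin n ↪ Fin p
  D_nn : ∀ i, D (nn i) = -Pi.single i 1
  d_nn : ∀ i, d (nn i) = 0

namespace LinProg

variable {m p n : ℕ} (L : LinProg m p n)

/-- The feasible region `P`. -/
def feasible : Set (Fin n → ℝ) := {x | L.A *ᵥ x = L.b ∧ L.D *ᵥ x ≤ L.d}

/-- The program is a 0/1-LP with equality matrix of full row rank: the feasible region is
a polytope all of whose extreme points have coordinates in `{0, 1}`. -/
structure IsZeroOne : Prop where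
  full_rank : LinearIndependent ℝ (fun r => L.A r)
  bounded : Bornology.IsBounded L.feasible
  zero_one : ∀ x ∈ L.feasible.extremePoints ℝ, ∀ i, x i = 0 ∨ x i = 1

/-- `x` is an optimal solution of the program. -/
def IsOptimalSolution (x : Fin n → ℝ) : Prop :=
  x ∈ L.feasible ∧ ∀ y ∈ L.feasible, L.c ⬝ᵥ y ≤ L.c ⬝ᵥ x

/-! ### Standard equality form `max {c'ᵀx' : A'x' = b', x' ≥ 0}` -/

/-- The inequalities other than the chosen copy of `x ≥ 0`; each gets a slack variable. -/
def SlackRow : Type := {k : Fin p // k ∉ Set.range L.nn}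

instance : DecidableEq L.SlackRow :=
  inferInstanceAs (DecidableEq {k : Fin p // k ∉ Set.range L.nn})

instance : Finite L.SlackRow :=
  inferInstanceAs (Finite {k : Fin p // k ∉ Set.range L.nn})

instance : Fintype L.SlackRow := Fintype.ofFinite _

/-- Rows of `A'`; they also serve as the positions of an ordered basis. -/
abbrev Row : Type := Fin m ⊕ L.SlackRow

/-- Columns of `A'`: original variables and slack variables. -/
abbrev Col : Type := Fin n ⊕ L.SlackRow

/-- `A' = [A 0; D̃ I]`, where `D̃` consists of the rows that get a slack variable. -/
def stdA : Matrix L.Row L.Col ℝ :=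
  Matrix.fromBlocks L.A 0 (fun k i => L.D k.val i) 1

def stdb : L.Row → ℝ := Sum.elim L.b (fun k => L.d k.val)

def stdc : L.Col → ℝ := Sum.elim L.c 0

/-! ### Bases -/

/-- The square matrix `A'_B` of the columns selected by `B`, where `B r` is the variable in
position `r` of the ordered basis. -/
def basisMatrix (B : L.Row → L.Col) : Matrix L.Row L.Row ℝ := L.stdA.submatrix id B

/-- The columns of `A'` selected by `B` are linearly independent (hence `B` is injective). -/
def IsBasis (B : L.Row → L.Col) : Prop :=
  LinearIndependent ℝ (fun r => fun s => L.stdA s (B r))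

/-- The variable `j` is nonbasic. -/
def Nonbasic (B : L.Row → L.Col) (j : L.Col) : Prop := j ∉ Set.range B

/-- Values `A'_B⁻¹ b'` of the basic variables. -/
def basicValue (B : L.Row → L.Col) : L.Row → ℝ := (L.basisMatrix B)⁻¹ *ᵥ L.stdb

/-- The basic solution: `x'(B) = A'_B⁻¹ b'` and `x'(N) = 0`. -/
def basicSolution (B : L.Row → L.Col) : L.Col → ℝ :=
  fun k => ∑ r, if B r = k then L.basicValue B r else 0

def IsFeasibleBasis (B : L.Row → L.Col) : Prop :=
  L.IsBasis B ∧ ∀ k, 0 ≤ L.basicSolution B k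

/-- The point of `ℝⁿ` associated with a basis (slack variables are dropped). -/
def vertex (B : L.Row → L.Col) : Fin n → ℝ := fun i => L.basicSolution B (Sum.inl i)

/-- `u = A'_B⁻¹ A'_j`. -/
def enteringColumn (B : L.Row → L.Col) (j : L.Col) : L.Row → ℝ :=
  (L.basisMatrix B)⁻¹ *ᵥ (fun s => L.stdA s j)

/-- Reduced cost `c'(j) - c'(B)ᵀ A'_B⁻¹ A'_j`. -/
def reducedCost (B : L.Row → L.Col) (j : L.Col) : ℝ :=
  L.stdc j - ∑ r, L.stdc (B r) * L.enteringColumn B j r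

/-- The stopping criterion of the Simplex method. -/
def IsOptimalBasis (B : L.Row → L.Col) : Prop :=
  ∀ j, L.Nonbasic B j → L.reducedCost B j ≤ 0

/-- The pivot direction of a nonbasic `j` in standard form: `z'(j) = 1`,
`z'(B) = -A'_B⁻¹ A'_j`, and `0` at the other nonbasic variables. -/
def stdDirection (B : L.Row → L.Col) (j : L.Col) : L.Col → ℝ :=
  fun k => (if k = j then 1 else 0) - ∑ r, if B r = k then L.enteringColumn B j r else 0

/-- The projection of the pivot direction to `ℝⁿ`; for nonbasic `j` these are
the generators of the extreme rays of the basic cone. -/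
def direction (B : L.Row → L.Col) (j : L.Col) : Fin n → ℝ :=
  fun i => L.stdDirection B j (Sum.inl i)

/-- The basic cone `C(B)`: `Az = 0`, together with the homogeneous versions of the inequalities
that belong to the nonbasic original variables and to the nonbasic slack variables. -/
def basicCone (B : L.Row → L.Col) : Set (Fin n → ℝ) :=
  {z | L.A *ᵥ z = 0 ∧
    (∀ i : Fin n, L.Nonbasic B (Sum.inl i) → (L.D *ᵥ z) (L.nn i) ≤ 0) ∧
    (∀ k : L.SlackRow, L.Nonbasic B (Sum.inr k) → (L.D *ᵥ z) k.val ≤ 0)}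

/-- The pivot at `B` with entering variable `j` is non-degenerate: one can move
a positive distance in the pivot direction inside the feasible region. -/
def Nondegenerate (B : L.Row → L.Col) (j : L.Col) : Prop :=
  ∃ ε : ℝ, 0 < ε ∧ L.vertex B + ε • L.direction B j ∈ L.feasible

/-! ### The leaving variable: lexicographic ratio test -/

/-- The order of the positions of a basis. -/
def RowLT : L.Row → L.Row → Prop := Sum.Lex (· < ·) (fun k l => k.val < l.val)

/-- Strict lexicographic order on vectors indexed by positions. -/
def LexLT (f g : L.Row → ℝ) : Prop :=
  ∃ r, f r < g r ∧ ∀ s, L.RowLT s r → f s = g s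

/-- The columns of the initial basis `B₀` in the current tableau: `A'_B⁻¹ A'_{B₀}`. -/
def lexTableau (B₀ B : L.Row → L.Col) : Matrix L.Row L.Row ℝ :=
  (L.basisMatrix B)⁻¹ * L.basisMatrix B₀

/-- Position `l` leaves, with entering variable `j`: among all positions with `u > 0`, the vector
`(x'(B(l)), row l of the tableau) / u(l)` is lexicographically smallest. -/
def Leaves (B₀ B : L.Row → L.Col) (j : L.Col) (l : L.Row) : Prop :=
  0 < L.enteringColumn B j l ∧
  ∀ r, r ≠ l → 0 < L.enteringColumn B j r →
    L.basicValue B l / L.enteringColumn B j l < L.basicValue B r / L.enteringColumn B j r ∨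
    (L.basicValue B l / L.enteringColumn B j l = L.basicValue B r / L.enteringColumn B j r ∧
      L.LexLT (fun s => L.lexTableau B₀ B l s / L.enteringColumn B j l)
        (fun s => L.lexTableau B₀ B r s / L.enteringColumn B j r))

/-! ### The entering variable: Slim Shadow pivot rule -/

/-- Every `c`-improving direction of the basic cone is `v`-improving. -/
def ShadowReady (v : Fin n → ℝ) (B : L.Row → L.Col) : Prop :=
  ∀ z ∈ L.basicCone B, 0 < L.c ⬝ᵥ z → 0 < v ⬝ᵥ z

/-- The auxiliary vector `v = 1 - 2x⁰`. -/
def slimVector (x₀ : Fin n → ℝ) : Fin n → ℝ := fun i => 1 - 2 * x₀ i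

/-- Main phase: an improving pivot direction that maximizes `cᵀz / vᵀz` over the improving pivot
directions (at a basis that is `ShadowReady` these all have `vᵀz > 0`). -/
def MainEnters (v : Fin n → ℝ) (B : L.Row → L.Col) (j : L.Col) : Prop :=
  0 < L.c ⬝ᵥ L.direction B j ∧
  ∀ k, L.Nonbasic B k → 0 < L.c ⬝ᵥ L.direction B k →
    (L.c ⬝ᵥ L.direction B k) / (v ⬝ᵥ L.direction B k) ≤
      (L.c ⬝ᵥ L.direction B j) / (v ⬝ᵥ L.direction B j)

/-- Initial phase: a pivot direction with `cᵀz > 0` and `vᵀz ≤ 0`, or with `vᵀz < 0`. -/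
def InitEnters (v : Fin n → ℝ) (B : L.Row → L.Col) (j : L.Col) : Prop :=
  (0 < L.c ⬝ᵥ L.direction B j ∧ v ⬝ᵥ L.direction B j ≤ 0) ∨ v ⬝ᵥ L.direction B j < 0

/-- A pivot of the Simplex method with the Slim Shadow pivot rule started at `B₀`:
`B` is not optimal, `j` enters and position `l` leaves. -/
def SlimShadowPivot (B₀ B : L.Row → L.Col) (j : L.Col) (l : L.Row) : Prop :=
  ¬ L.IsOptimalBasis B ∧ L.Nonbasic B j ∧
  (L.ShadowReady (slimVector (L.vertex B₀)) B → L.MainEnters (slimVector (L.vertex B₀)) B j) ∧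
  (¬ L.ShadowReady (slimVector (L.vertex B₀)) B → L.InitEnters (slimVector (L.vertex B₀)) B j) ∧
  L.Leaves B₀ B j l

/-- The first `T` pivots of an execution started at the basis `B₀`: pivot number `t` takes place at
the basis `B t`, enters `j t` and replaces with it the variable in position `l t`. -/
structure IsSlimShadowRun (B₀ : L.Row → L.Col) (T : ℕ)
    (B : ℕ → L.Row → L.Col) (j : ℕ → L.Col) (l : ℕ → L.Row) : Prop where
  start : B 0 = B₀
  pivot : ∀ t < T, L.SlimShadowPivot B₀ (B t) (j t) (l t)
  next : ∀ t < T, B (t + 1) = Function.update (B t) (l t) (j t)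

end LinProg

end

/-!
The argument lives in the standard equality form. The entries of a vector in the kernel of `A'` are
its coefficients with respect to the pivot directions (`dotProduct_eq_sum_stdDirection`), so signs
of functionals on a basic cone, or on feasible moves away from a vertex, can be read off from the
pivot directions. This gives optimality at an optimal basis and, at a non-optimal basis, an
admissible entering variable; a leaving variable then exists because the polytope is bounded and
the rows of `A'_B⁻¹ A'_{B₀}` are linearly independent.

*Phases.* Write `v = 1 - 2x⁰`. At a basis whose cone satisfies the condition of the main phase, the
largest ratio `λ = cᵀzʲ / vᵀzʲ` of the shadow rule makes the basis optimal for `c - λv`, with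
reduced cost zero for the entering variable (`ShadowReady.le_ratio_mul`). Hence the next basis is
optimal for `c - λv` too, and the main phase is never left (`ShadowReady.update`).

*Counting.* On 0/1 points `vᵀ(x - x⁰)` is the Hamming distance to `x⁰`, and by the Krein–Milman
theorem the polytope lies in the unit cube, so `x⁰` is the unique minimizer of `v` over it. As long
as the initial phase lasts, the vertex is `x⁰`, and the entering directions, not being
`v`-increasing, cannot leave it: these pivots are degenerate (`InitEnters.not_nondegenerate`). In
the main phase all entering directions increase `v`, so every non-degenerate pivot increases the
Hamming distance to `x⁰`, an integer between `0` and `n`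
(`IsSlimShadowRun.ncard_nondegenerate_le`).

*Termination.* The lexicographic rule keeps the rows of the tableau `A'_B⁻¹ [b' | A'_{B₀}]`
lexicographically positive (`IsLexFeasible.update`), and therefore a pivot strictly increases the
lexicographic value of every functional that improves along the pivot direction, even if the pivot
is degenerate (`IsLexFeasible.lexValue_lt`). All main pivots improve `c`, and all initial pivots
improve `c - Mv` for one large `M` (`exists_initEnters_improving`). So each phase visits a basis at
most once (`IsSlimShadowRun.length_le`).
-/

noncomputable section

namespace LinProg

variable {m p n : ℕ} {L : LinProg m p n}

/-! ### Bases in the standard equality form -/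

/-- The vector on the columns that takes the values `w` at the basic variables and vanishes at the
nonbasic ones (for injective `B`). -/
def embed (L : LinProg m p n) (B : L.Row → L.Col) (w : L.Row → ℝ) : L.Col → ℝ :=
  fun k => ∑ r, if B r = k then w r else 0

/-- A functional on `ℝⁿ` as a functional on the columns of the standard form. -/
def extend (L : LinProg m p n) (g : Fin n → ℝ) : L.Col → ℝ := Sum.elim g 0

/-- The standard-form point over `x`: the slack variables are `d - D x`. -/
def lift (L : LinProg m p n) (x : Fin n → ℝ) : L.Col → ℝ :=
  Sum.elim x (fun k => L.d k.val - (L.D *ᵥ x) k.val)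

/-- The standard-form vector over a direction `z`: the slack variables are `-D z`. -/
def liftDir (L : LinProg m p n) (z : Fin n → ℝ) : L.Col → ℝ :=
  Sum.elim z (fun k => -(L.D *ᵥ z) k.val)

theorem extend_dotProduct (g : Fin n → ℝ) (y : L.Col → ℝ) :
    L.extend g ⬝ᵥ y = g ⬝ᵥ fun i => y (Sum.inl i) := by
  simp [extend, dotProduct, Fintype.sum_sum_type]

theorem extend_dotProduct_stdDirection (g : Fin n → ℝ) (B : L.Row → L.Col) (j : L.Col) :
    L.extend g ⬝ᵥ L.stdDirection B j = g ⬝ᵥ L.direction B j :=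
  extend_dotProduct g _

theorem dotProduct_embed (g : L.Col → ℝ) (B : L.Row → L.Col) (w : L.Row → ℝ) :
    g ⬝ᵥ L.embed B w = ∑ r, g (B r) * w r := by
  simp only [dotProduct, embed, Finset.mul_sum]
  rw [Finset.sum_comm]
  simp

theorem stdA_mulVec_embed (B : L.Row → L.Col) (w : L.Row → ℝ) :
    L.stdA *ᵥ L.embed B w = L.basisMatrix B *ᵥ w := by
  ext s
  exact dotProduct_embed (L.stdA s) B w

theorem embed_apply {B : L.Row → L.Col} (hB : Function.Injective B) (w : L.Row → ℝ) (r : L.Row) :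
    L.embed B w (B r) = w r := by
  simp [embed, hB.eq_iff]

theorem embed_nonbasic {B : L.Row → L.Col} {k : L.Col} (hk : L.Nonbasic B k) (w : L.Row → ℝ) :
    L.embed B w k = 0 :=
  Finset.sum_eq_zero fun r _ => if_neg fun h => hk ⟨r, h⟩

theorem eq_embed {B : L.Row → L.Col} (hB : Function.Injective B) {y : L.Col → ℝ}
    (hy : ∀ k, L.Nonbasic B k → y k = 0) : y = L.embed B (fun r => y (B r)) := by
  ext k
  by_cases hk : L.Nonbasic B k
  · rw [hy k hk, embed_nonbasic hk]
  · obtain ⟨r, rfl⟩ := not_not.1 hk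
    rw [embed_apply hB]

theorem isBasis_iff {B : L.Row → L.Col} : L.IsBasis B ↔ IsUnit (L.basisMatrix B) :=
  linearIndependent_cols_iff_isUnit (A := L.basisMatrix B)

theorem IsBasis.injective {B : L.Row → L.Col} (h : L.IsBasis B) : Function.Injective B := by
  intro r s hrs
  exact LinearIndependent.injective h (by simp only [hrs])

theorem IsBasis.mulVec_inv {B : L.Row → L.Col} (h : L.IsBasis B) (β : L.Row → ℝ) :
    L.basisMatrix B *ᵥ ((L.basisMatrix B)⁻¹ *ᵥ β) = β := by
  have := (Matrix.isUnit_iff_isUnit_det _).1 (isBasis_iff.1 h)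
  rw [mulVec_mulVec, Matrix.mul_nonsing_inv _ this, one_mulVec]

theorem IsBasis.inv_mulVec {B : L.Row → L.Col} (h : L.IsBasis B) (w : L.Row → ℝ) :
    (L.basisMatrix B)⁻¹ *ᵥ (L.basisMatrix B *ᵥ w) = w := by
  have := (Matrix.isUnit_iff_isUnit_det _).1 (isBasis_iff.1 h)
  rw [mulVec_mulVec, Matrix.nonsing_inv_mul _ this, one_mulVec]

theorem stdDirection_eq (B : L.Row → L.Col) (j : L.Col) :
    L.stdDirection B j = Pi.single j 1 - L.embed B (L.enteringColumn B j) := by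
  ext k
  simp [stdDirection, embed, Pi.single_apply]

theorem dotProduct_stdDirection (g : L.Col → ℝ) (B : L.Row → L.Col) (j : L.Col) :
    g ⬝ᵥ L.stdDirection B j = g j - ∑ r, g (B r) * L.enteringColumn B j r := by
  rw [stdDirection_eq, dotProduct_sub, dotProduct_embed, dotProduct_single, mul_one]

theorem reducedCost_eq (B : L.Row → L.Col) (j : L.Col) :
    L.reducedCost B j = L.c ⬝ᵥ L.direction B j := by
  rw [← extend_dotProduct_stdDirection, dotProduct_stdDirection]
  rfl

theorem stdDirection_self {B : L.Row → L.Col} {j : L.Col} (hj : L.Nonbasic B j) :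
    L.stdDirection B j j = 1 := by
  simp [stdDirection_eq, embed_nonbasic hj]

theorem stdDirection_of_ne {B : L.Row → L.Col} {j k : L.Col} (hk : L.Nonbasic B k) (h : k ≠ j) :
    L.stdDirection B j k = 0 := by
  simp [stdDirection_eq, embed_nonbasic hk, h]

theorem stdDirection_basic {B : L.Row → L.Col} (hB : Function.Injective B) {j : L.Col}
    (hj : L.Nonbasic B j) (r : L.Row) :
    L.stdDirection B j (B r) = -L.enteringColumn B j r := by
  have : B r ≠ j := fun h => hj ⟨r, h⟩
  simp [stdDirection_eq, embed_apply hB, this]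

theorem IsBasis.stdA_mulVec_stdDirection {B : L.Row → L.Col} (hB : L.IsBasis B) (j : L.Col) :
    L.stdA *ᵥ L.stdDirection B j = 0 := by
  rw [stdDirection_eq, mulVec_sub, stdA_mulVec_embed, enteringColumn, hB.mulVec_inv,
    mulVec_single_one, sub_eq_zero]
  rfl

/-- For a basic variable the formula for the pivot direction gives zero, so sums over the nonbasic
variables may be taken over all columns. -/
theorem stdDirection_eq_zero {B : L.Row → L.Col} (hB : L.IsBasis B) (r : L.Row) :
    L.stdDirection B (B r) = 0 := by
  have h : L.enteringColumn B (B r) = Pi.single r 1 := by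
    rw [← hB.inv_mulVec (Pi.single r 1), mulVec_single_one]
    rfl
  ext k
  rw [stdDirection_eq, h]
  by_cases hk : B r = k
  · subst hk
    simp [embed_apply hB.injective]
  · have : ∀ s, (if B s = k then (Pi.single r 1 : L.Row → ℝ) s else 0) = 0 := by
      intro s
      by_cases hs : s = r
      · subst hs; simp [hk]
      · simp [hs]
    simp [embed, this, Ne.symm hk]

/-- The pivot directions span the kernel of the standard-form matrix: the coefficients of a
kernel vector are its own entries (basic columns contribute the zero vector). -/
theorem dotProduct_eq_sum_stdDirection {B : L.Row → L.Col} {y : L.Col → ℝ}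
    (hy : L.stdA *ᵥ y = 0) (g : L.Col → ℝ) :
    g ⬝ᵥ y = ∑ k, y k * (g ⬝ᵥ L.stdDirection B k) := by
  have h : ∀ r, ∑ k, y k * L.enteringColumn B k r = 0 := by
    intro r
    have h1 : ((L.basisMatrix B)⁻¹ * L.stdA) *ᵥ y = 0 := by
      rw [← mulVec_mulVec, hy, mulVec_zero]
    have h2 := congrFun h1 r
    simp only [mulVec, dotProduct, Pi.zero_apply] at h2
    rw [← h2]
    exact Finset.sum_congr rfl fun k _ => mul_comm _ _
  simp only [dotProduct_stdDirection, mul_sub, Finset.sum_sub_distrib, Finset.mul_sum]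
  rw [Finset.sum_comm (s := Finset.univ) (t := Finset.univ)]
  have h3 : ∀ r, ∑ k, y k * (g (B r) * L.enteringColumn B k r) = 0 := by
    intro r
    rw [← mul_zero (g (B r)), ← h r, Finset.mul_sum]
    exact Finset.sum_congr rfl fun k _ => by ring
  simp only [h3, Finset.sum_const_zero, sub_zero, dotProduct]
  exact Finset.sum_congr rfl fun k _ => mul_comm _ _

theorem IsBasis.eq_embed_inv {B : L.Row → L.Col} (hB : L.IsBasis B) {y : L.Col → ℝ}
    {β : L.Row → ℝ} (hy : L.stdA *ᵥ y = β) (h0 : ∀ k, L.Nonbasic B k → y k = 0) :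
    y = L.embed B ((L.basisMatrix B)⁻¹ *ᵥ β) := by
  have h := eq_embed hB.injective h0
  have h1 : L.basisMatrix B *ᵥ (fun r => y (B r)) = β := by
    rw [← stdA_mulVec_embed, ← h, hy]
  rw [← h1, hB.inv_mulVec]
  exact h

theorem IsBasis.stdA_mulVec_basicSolution {B : L.Row → L.Col} (hB : L.IsBasis B) :
    L.stdA *ᵥ L.basicSolution B = L.stdb :=
  (stdA_mulVec_embed B _).trans (hB.mulVec_inv _)

/-! ### The exchange of one basic variable -/

theorem nonbasic_update {B : L.Row → L.Col} {j k : L.Col} (l : L.Row) (hk : L.Nonbasic B k)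
    (hkj : k ≠ j) : L.Nonbasic (Function.update B l j) k := by
  rintro ⟨r, hr⟩
  by_cases h : r = l
  · subst h
    rw [Function.update_self] at hr
    exact hkj hr.symm
  · rw [Function.update_of_ne h] at hr
    exact hk ⟨r, hr⟩

theorem injective_update {B : L.Row → L.Col} {j : L.Col} (l : L.Row) (hB : Function.Injective B)
    (hj : L.Nonbasic B j) : Function.Injective (Function.update B l j) := by
  intro r s h
  by_cases hr : r = l <;> by_cases hs : s = l
  · rw [hr, hs]
  · rw [hr, Function.update_self, Function.update_of_ne hs] at h
    exact absurd ⟨s, h.symm⟩ hj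
  · rw [hs, Function.update_self, Function.update_of_ne hr] at h
    exact absurd ⟨r, h⟩ hj
  · rw [Function.update_of_ne hs, Function.update_of_ne hr] at h
    exact hB h

theorem nonbasic_update_leaving {B : L.Row → L.Col} {j : L.Col} (l : L.Row)
    (hB : Function.Injective B) (hj : L.Nonbasic B j) :
    L.Nonbasic (Function.update B l j) (B l) := by
  rintro ⟨r, hr⟩
  by_cases h : r = l
  · subst h
    rw [Function.update_self] at hr
    exact hj ⟨r, hr.symm⟩
  · rw [Function.update_of_ne h] at hr
    exact h (hB hr)

theorem eq_or_nonbasic_of_nonbasic_update {B : L.Row → L.Col} {j k : L.Col} {l : L.Row}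
    (hk : L.Nonbasic (Function.update B l j) k) : k = B l ∨ (L.Nonbasic B k ∧ k ≠ j) := by
  by_cases h : L.Nonbasic B k
  · refine Or.inr ⟨h, fun hkj => hk ⟨l, ?_⟩⟩
    rw [Function.update_self, hkj]
  · obtain ⟨r, rfl⟩ := not_not.1 h
    by_cases hr : r = l
    · exact Or.inl (by rw [hr])
    · exact absurd ⟨r, Function.update_of_ne hr _ _⟩ hk

theorem IsBasis.update {B : L.Row → L.Col} (hB : L.IsBasis B) {j : L.Col} (hj : L.Nonbasic B j)
    {l : L.Row} (hl : L.enteringColumn B j l ≠ 0) : L.IsBasis (Function.update B l j) := by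
  have hinj := injective_update l hB.injective hj
  rw [isBasis_iff, ← mulVec_injective_iff_isUnit]
  refine (injective_iff_map_eq_zero (Matrix.mulVecLin _)).2 fun w hw => ?_
  rw [mulVecLin_apply, ← stdA_mulVec_embed] at hw
  set y := L.embed (Function.update B l j) w with hy
  have hyj : y j = w l := by
    rw [hy, ← embed_apply hinj w l, Function.update_self]
  -- a kernel vector supported on the new basis is a multiple of the pivot direction
  have key : ∀ k, y k = w l * L.stdDirection B j k := by
    intro k
    have h1 := dotProduct_eq_sum_stdDirection (B := B) hw (Pi.single k 1)
    simp only [single_one_dotProduct] at h1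
    rw [h1, Finset.sum_eq_single j, hyj]
    · intro i _ hij
      by_cases hi : L.Nonbasic B i
      · rw [hy, embed_nonbasic (nonbasic_update l hi hij), zero_mul]
      · obtain ⟨r, rfl⟩ := not_not.1 hi
        rw [stdDirection_eq_zero hB, Pi.zero_apply, mul_zero]
    · simp
  have h0 := key (B l)
  rw [hy, embed_nonbasic (nonbasic_update_leaving l hB.injective hj),
    stdDirection_basic hB.injective hj] at h0
  have hwl : w l = 0 := by
    rcases mul_eq_zero.1 h0.symm with h | h
    · exact h
    · exact absurd (neg_eq_zero.1 h) hl
  ext r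
  rw [← embed_apply hinj w r, ← hy, key, hwl, zero_mul, Pi.zero_apply]

/-- Pivoting moves every basic solution (for an arbitrary right-hand side `β`) along the pivot
direction, by the ratio at the leaving position. -/
theorem embed_update {B : L.Row → L.Col} (hB : L.IsBasis B) {j : L.Col} (hj : L.Nonbasic B j)
    {l : L.Row} (hl : L.enteringColumn B j l ≠ 0) (β : L.Row → ℝ) :
    L.embed (Function.update B l j) ((L.basisMatrix (Function.update B l j))⁻¹ *ᵥ β) =
      L.embed B ((L.basisMatrix B)⁻¹ *ᵥ β) +
        (((L.basisMatrix B)⁻¹ *ᵥ β) l / L.enteringColumn B j l) • L.stdDirection B j := by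
  refine ((hB.update hj hl).eq_embed_inv ?_ ?_).symm
  · rw [mulVec_add, mulVec_smul, hB.stdA_mulVec_stdDirection, smul_zero, add_zero,
      stdA_mulVec_embed, hB.mulVec_inv]
  · intro k hk
    rw [Pi.add_apply, Pi.smul_apply, smul_eq_mul]
    rcases eq_or_nonbasic_of_nonbasic_update hk with rfl | ⟨hk, hkj⟩
    · rw [embed_apply hB.injective, stdDirection_basic hB.injective hj]
      field_simp
      ring
    · rw [embed_nonbasic hk, stdDirection_of_ne hk hkj, mul_zero, add_zero]

theorem inv_mulVec_update_self {B : L.Row → L.Col} (hB : L.IsBasis B) {j : L.Col}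
    (hj : L.Nonbasic B j) {l : L.Row} (hl : L.enteringColumn B j l ≠ 0) (β : L.Row → ℝ) :
    ((L.basisMatrix (Function.update B l j))⁻¹ *ᵥ β) l =
      ((L.basisMatrix B)⁻¹ *ᵥ β) l / L.enteringColumn B j l := by
  have h := congrFun (embed_update hB hj hl β) (Function.update B l j l)
  rw [embed_apply (injective_update l hB.injective hj), Function.update_self, Pi.add_apply,
    Pi.smul_apply, embed_nonbasic hj, stdDirection_self hj, zero_add, smul_eq_mul, mul_one] at h
  exact h

theorem inv_mulVec_update_of_ne {B : L.Row → L.Col} (hB : L.IsBasis B) {j : L.Col}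
    (hj : L.Nonbasic B j) {l r : L.Row} (hl : L.enteringColumn B j l ≠ 0) (hr : r ≠ l)
    (β : L.Row → ℝ) :
    ((L.basisMatrix (Function.update B l j))⁻¹ *ᵥ β) r = ((L.basisMatrix B)⁻¹ *ᵥ β) r -
      ((L.basisMatrix B)⁻¹ *ᵥ β) l / L.enteringColumn B j l * L.enteringColumn B j r := by
  have h := congrFun (embed_update hB hj hl β) (Function.update B l j r)
  rw [embed_apply (injective_update l hB.injective hj), Function.update_of_ne hr, Pi.add_apply,
    Pi.smul_apply, embed_apply hB.injective, stdDirection_basic hB.injective hj, smul_eq_mul] at h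
  rw [h]
  ring

/-! ### The original program and its standard form -/

theorem stdA_inl_inl (r : Fin m) (i : Fin n) : L.stdA (Sum.inl r) (Sum.inl i) = L.A r i := rfl

theorem stdA_inl_inr (r : Fin m) (k : L.SlackRow) : L.stdA (Sum.inl r) (Sum.inr k) = 0 := rfl

theorem stdA_inr_inl (k : L.SlackRow) (i : Fin n) :
    L.stdA (Sum.inr k) (Sum.inl i) = L.D k.val i := rfl

theorem stdA_inr_inr (k k' : L.SlackRow) :
    L.stdA (Sum.inr k) (Sum.inr k') = if k = k' then 1 else 0 := one_apply

theorem stdA_mulVec_elim (x : Fin n → ℝ) (s : L.SlackRow → ℝ) :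
    L.stdA *ᵥ Sum.elim x s = Sum.elim (L.A *ᵥ x) (fun k => (L.D *ᵥ x) k.val + s k) := by
  ext (r | k)
  · simp [mulVec, dotProduct, Fintype.sum_sum_type, stdA_inl_inl, stdA_inl_inr]
  · simp [mulVec, dotProduct, Fintype.sum_sum_type, stdA_inr_inl, stdA_inr_inr]

theorem eq_lift {y : L.Col → ℝ} (hy : L.stdA *ᵥ y = L.stdb) :
    L.A *ᵥ (fun i => y (Sum.inl i)) = L.b ∧ y = L.lift (fun i => y (Sum.inl i)) := by
  have h : y = Sum.elim (fun i => y (Sum.inl i)) (fun k => y (Sum.inr k)) := by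
    ext (i | k) <;> rfl
  rw [h, stdA_mulVec_elim] at hy
  refine ⟨funext fun r => congrFun hy (Sum.inl r), ?_⟩
  ext (i | k)
  · rfl
  · have := congrFun hy (Sum.inr k)
    simp only [Sum.elim_inr, stdb] at this
    simp only [lift, Sum.elim_inr]
    linarith

theorem stdA_mulVec_lift {x : Fin n → ℝ} (hx : L.A *ᵥ x = L.b) :
    L.stdA *ᵥ L.lift x = L.stdb := by
  rw [lift, stdA_mulVec_elim, hx]
  ext (r | k) <;> simp [stdb]

theorem stdA_mulVec_liftDir {z : Fin n → ℝ} (hz : L.A *ᵥ z = 0) :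
    L.stdA *ᵥ L.liftDir z = 0 := by
  rw [liftDir, stdA_mulVec_elim, hz]
  ext (r | k) <;> simp

theorem D_mulVec_nn (x : Fin n → ℝ) (i : Fin n) : (L.D *ᵥ x) (L.nn i) = -x i := by
  rw [mulVec, L.D_nn, neg_dotProduct, single_one_dotProduct]

theorem mem_feasible_iff {x : Fin n → ℝ} :
    x ∈ L.feasible ↔ L.A *ᵥ x = L.b ∧ ∀ k, 0 ≤ L.lift x k := by
  refine and_congr_right fun _ => ⟨fun h k => ?_, fun h k => ?_⟩
  · rcases k with i | k
    · have := h (L.nn i)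
      rw [D_mulVec_nn, L.d_nn] at this
      exact neg_nonpos.1 this
    · exact sub_nonneg.2 (h k.val)
  · by_cases hk : k ∈ Set.range L.nn
    · obtain ⟨i, rfl⟩ := hk
      rw [D_mulVec_nn, L.d_nn]
      exact neg_nonpos.2 (h (Sum.inl i))
    · exact sub_nonneg.1 (h (Sum.inr ⟨k, hk⟩))

theorem mem_feasible_of_std {y : L.Col → ℝ} (hy : L.stdA *ᵥ y = L.stdb) (h0 : ∀ k, 0 ≤ y k) :
    (fun i => y (Sum.inl i)) ∈ L.feasible := by
  obtain ⟨h1, h2⟩ := eq_lift hy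
  exact mem_feasible_iff.2 ⟨h1, fun k => h2 ▸ h0 k⟩

theorem IsBasis.lift_vertex {B : L.Row → L.Col} (hB : L.IsBasis B) :
    L.lift (L.vertex B) = L.basicSolution B :=
  (eq_lift hB.stdA_mulVec_basicSolution).2.symm

theorem IsBasis.lift_vertex_add {B : L.Row → L.Col} (hB : L.IsBasis B) (j : L.Col) (ε : ℝ) :
    L.lift (L.vertex B + ε • L.direction B j) = L.basicSolution B + ε • L.stdDirection B j := by
  have h : L.stdA *ᵥ (L.basicSolution B + ε • L.stdDirection B j) = L.stdb := by
    rw [mulVec_add, mulVec_smul, hB.stdA_mulVec_stdDirection, smul_zero, add_zero,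
      hB.stdA_mulVec_basicSolution]
  exact (eq_lift h).2.symm

theorem IsFeasibleBasis.vertex_mem {B : L.Row → L.Col} (hB : L.IsFeasibleBasis B) :
    L.vertex B ∈ L.feasible :=
  mem_feasible_of_std hB.1.stdA_mulVec_basicSolution hB.2

theorem IsBasis.direction_ne_zero {B : L.Row → L.Col} (hB : L.IsBasis B) {j : L.Col}
    (hj : L.Nonbasic B j) : L.direction B j ≠ 0 := by
  intro h
  have h1 := hB.lift_vertex_add j 1
  rw [h, smul_zero, add_zero, hB.lift_vertex, one_smul, left_eq_add] at h1
  have := congrFun h1 j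
  rw [stdDirection_self hj] at this
  exact one_ne_zero this

/-- Vertices of feasible bases are extreme points, hence 0/1 points in a 0/1-LP. -/
theorem IsFeasibleBasis.vertex_mem_extremePoints {B : L.Row → L.Col} (hB : L.IsFeasibleBasis B) :
    L.vertex B ∈ L.feasible.extremePoints ℝ := by
  refine ⟨hB.vertex_mem, ?_⟩
  intro x hx y hy hxy
  obtain ⟨a, b, ha, hb, hab, h⟩ := hxy
  obtain ⟨hxA, hx0⟩ := mem_feasible_iff.1 hx
  obtain ⟨hyA, hy0⟩ := mem_feasible_iff.1 hy
  -- a nonbasic entry of the vertex is zero, and it is a convex combination of nonnegative entries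
  have hlift : a • L.lift x + b • L.lift y = L.basicSolution B := by
    rw [← hB.1.lift_vertex, ← h]
    ext (i | k)
    · simp [lift]
    · have h1 : a * L.d k.val + b * L.d k.val = L.d k.val := by rw [← add_mul, hab, one_mul]
      simp only [lift, mulVec_add, mulVec_smul, Pi.add_apply, Pi.smul_apply, smul_eq_mul,
        Sum.elim_inr]
      linarith
  have hx1 : ∀ k, L.Nonbasic B k → L.lift x k = 0 := by
    intro k hk
    have h1 : a * L.lift x k + b * L.lift y k = 0 :=
      (congrFun hlift k).trans (embed_nonbasic hk _)
    have h2 := mul_nonneg ha.le (hx0 k)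
    have h3 := mul_nonneg hb.le (hy0 k)
    have h4 : a * L.lift x k = 0 := by linarith
    exact (mul_eq_zero.1 h4).resolve_left ha.ne'
  have h1 := hB.1.eq_embed_inv (stdA_mulVec_lift hxA) hx1
  ext i
  exact congrFun h1 (Sum.inl i)

/-! ### Lexicographic positivity -/

theorem rowLT_irrefl (r : L.Row) : ¬ L.RowLT r r := by
  rcases r with r | r <;> simp [RowLT]

theorem rowLT_trans {r s t : L.Row} (h₁ : L.RowLT r s) (h₂ : L.RowLT s t) : L.RowLT r t := by
  rcases r with r | r <;> rcases s with s | s <;> rcases t with t | t <;>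
    simp only [RowLT, Sum.lex_inl_inl, Sum.lex_inr_inr, Sum.lex_inr_inl, Sum.Lex.sep] at h₁ h₂ ⊢ <;>
    exact lt_trans h₁ h₂

theorem rowLT_trichotomy (r s : L.Row) : L.RowLT r s ∨ r = s ∨ L.RowLT s r := by
  rcases r with r | r <;> rcases s with s | s
  · simpa [RowLT] using lt_trichotomy r s
  · simp [RowLT]
  · simp [RowLT]
  · rcases lt_trichotomy r.val s.val with h | h | h
    · exact Or.inl (Sum.Lex.inr h)
    · exact Or.inr (Or.inl (congrArg Sum.inr (Subtype.ext h)))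
    · exact Or.inr (Or.inr (Sum.Lex.inr h))

theorem lexLT_iff_sub {f g : L.Row → ℝ} : L.LexLT f g ↔ L.LexLT 0 (g - f) := by
  simp only [LexLT, Pi.zero_apply, Pi.sub_apply, sub_pos, @eq_comm ℝ 0, sub_eq_zero]
  simp only [@eq_comm ℝ (f _)]

theorem lexLT_zero_add {f g : L.Row → ℝ} (hf : L.LexLT 0 f) (hg : L.LexLT 0 g) :
    L.LexLT 0 (f + g) := by
  obtain ⟨r, hr, hr'⟩ := hf
  obtain ⟨s, hs, hs'⟩ := hg
  simp only [Pi.zero_apply] at hr hr' hs hs'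
  rcases rowLT_trichotomy r s with h | rfl | h
  · refine ⟨r, ?_, fun q hq => ?_⟩
    · simpa [← hs' r h] using hr
    · simp [← hr' q hq, ← hs' q (rowLT_trans hq h)]
  · refine ⟨r, ?_, fun q hq => ?_⟩
    · simpa using add_pos hr hs
    · simp [← hr' q hq, ← hs' q hq]
  · refine ⟨s, ?_, fun q hq => ?_⟩
    · simpa [← hr' s h] using hs
    · simp [← hs' q hq, ← hr' q (rowLT_trans hq h)]

/-- The sign is decided by the first nonzero entry. -/
theorem lexLT_zero_or_neg {f : L.Row → ℝ} (hf : f ≠ 0) : L.LexLT 0 f ∨ L.LexLT 0 (-f) := by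
  have : IsTrans L.Row L.RowLT := ⟨fun _ _ _ => rowLT_trans⟩
  have : Std.Irrefl L.RowLT := ⟨rowLT_irrefl⟩
  have hwf : WellFounded L.RowLT := Finite.wellFounded_of_trans_of_irrefl _
  obtain ⟨r, hr, hmin⟩ := hwf.has_min {r | f r ≠ 0} (Function.ne_iff.1 hf)
  have h0 : ∀ s, L.RowLT s r → f s = 0 := fun s hs => by
    by_contra h
    exact hmin s h hs
  rcases lt_or_gt_of_ne hr with h | h
  · exact Or.inr ⟨r, by simpa using h, fun s hs => by simp [h0 s hs]⟩
  · exact Or.inl ⟨r, h, fun s hs => by simp [h0 s hs]⟩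

/-- Lexicographic positivity of a value together with a row of the tableau. -/
def LexPos (L : LinProg m p n) (f : ℝ × (L.Row → ℝ)) : Prop :=
  0 < f.1 ∨ (f.1 = 0 ∧ L.LexLT 0 f.2)

theorem not_lexPos_zero : ¬ L.LexPos 0 := by
  rintro (h | ⟨_, r, h, _⟩)
  · exact lt_irrefl _ h
  · exact lt_irrefl _ h

theorem LexPos.add {f g : ℝ × (L.Row → ℝ)} (hf : L.LexPos f) (hg : L.LexPos g) :
    L.LexPos (f + g) := by
  rcases hf with hf | ⟨hf, hf'⟩ <;> rcases hg with hg | ⟨hg, hg'⟩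
  · exact Or.inl (add_pos hf hg)
  · exact Or.inl (by simpa [hg] using hf)
  · exact Or.inl (by simpa [hf] using hg)
  · exact Or.inr ⟨by simp [hf, hg], lexLT_zero_add hf' hg'⟩

theorem LexPos.smul {f : ℝ × (L.Row → ℝ)} (hf : L.LexPos f) {a : ℝ} (ha : 0 < a) :
    L.LexPos (a • f) := by
  rcases hf with hf | ⟨hf, r, hr, hr'⟩
  · exact Or.inl (mul_pos ha hf)
  · refine Or.inr ⟨by simp [hf], r, mul_pos ha hr, fun s hs => ?_⟩
    simp [← hr' s hs]

theorem LexPos.fst_nonneg {f : ℝ × (L.Row → ℝ)} (hf : L.LexPos f) : 0 ≤ f.1 :=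
  hf.elim le_of_lt fun h => h.1.ge

theorem lexPos_or_neg {f : ℝ × (L.Row → ℝ)} (hf : f.2 ≠ 0) : L.LexPos f ∨ L.LexPos (-f) := by
  rcases lt_trichotomy f.1 0 with h | h | h
  · exact Or.inr (Or.inl (by simpa using h))
  · refine (lexLT_zero_or_neg hf).imp (fun h' => Or.inr ⟨h, h'⟩) fun h' => Or.inr ⟨by simp [h], h'⟩
  · exact Or.inl (Or.inl h)

/-! ### The lexicographic tableau -/

/-- Row `r` of the tableau used by the lexicographic rule: the value of the basic variable,
followed by the row of `A'_B⁻¹ A'_{B₀}`. -/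
def tableauRow (L : LinProg m p n) (B₀ B : L.Row → L.Col) (r : L.Row) : ℝ × (L.Row → ℝ) :=
  (L.basicValue B r, L.lexTableau B₀ B r)

/-- The lexicographic form of feasibility, invariant under lexicographic pivots. -/
def IsLexFeasible (L : LinProg m p n) (B₀ B : L.Row → L.Col) : Prop :=
  L.IsBasis B ∧ ∀ r, L.LexPos (L.tableauRow B₀ B r)

/-- The value of the functional `g` on the columns at the basis `B`, as the vector of its values for
`b'` and for each column of `A'_{B₀}` in place of the right-hand side. -/
def lexValue (L : LinProg m p n) (B₀ : L.Row → L.Col) (g : L.Col → ℝ) (B : L.Row → L.Col) :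
    ℝ × (L.Row → ℝ) :=
  ∑ r, g (B r) • L.tableauRow B₀ B r

theorem IsLexFeasible.isFeasibleBasis {B₀ B : L.Row → L.Col} (h : L.IsLexFeasible B₀ B) :
    L.IsFeasibleBasis B := by
  refine ⟨h.1, fun k => Finset.sum_nonneg fun r _ => ?_⟩
  split_ifs
  · exact (h.2 r).fst_nonneg
  · exact le_rfl

theorem IsFeasibleBasis.isLexFeasible_self {B₀ : L.Row → L.Col} (h : L.IsFeasibleBasis B₀) :
    L.IsLexFeasible B₀ B₀ := by
  refine ⟨h.1, fun r => ?_⟩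
  have h1 : L.lexTableau B₀ B₀ = 1 :=
    nonsing_inv_mul _ ((isUnit_iff_isUnit_det _).1 (isBasis_iff.1 h.1))
  have h2 : 0 ≤ L.basicValue B₀ r := by
    rw [← embed_apply h.1.injective (L.basicValue B₀) r]
    exact h.2 _
  refine h2.lt_or_eq.imp id fun h2 => ⟨h2.symm, r, ?_, fun s hs => ?_⟩
  · simp [tableauRow, h1]
  · have : r ≠ s := by
      rintro rfl
      exact rowLT_irrefl _ hs
    simp [tableauRow, h1, one_apply_ne this]

/-- The rows of the tableau stay linearly independent, so the ratio test has no ties. -/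
theorem lexTableau_row_ne {B₀ B : L.Row → L.Col} (h₀ : L.IsBasis B₀) (h : L.IsBasis B)
    {r l : L.Row} (hrl : r ≠ l) {a b : ℝ} (ha : a ≠ 0) :
    a • L.lexTableau B₀ B r - b • L.lexTableau B₀ B l ≠ 0 := by
  have hu : IsUnit (L.lexTableau B₀ B) :=
    ((Matrix.isUnit_nonsing_inv_iff).2 (isBasis_iff.1 h)).mul (isBasis_iff.1 h₀)
  have hli := linearIndependent_rows_iff_isUnit.2 hu
  have hpair : LinearIndependent ℝ ![L.lexTableau B₀ B r, L.lexTableau B₀ B l] := by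
    have he : ![L.lexTableau B₀ B r, L.lexTableau B₀ B l] =
        (L.lexTableau B₀ B).row ∘ ![r, l] := by
      ext i
      fin_cases i <;> rfl
    rw [he]
    exact hli.comp _ (by simpa using hrl)
  intro h0
  refine ha (LinearIndependent.pair_iff.1 hpair a (-b) ?_).1
  rw [neg_smul, ← sub_eq_add_neg]
  exact h0

theorem leaves_iff {B₀ B : L.Row → L.Col} {j : L.Col} {l : L.Row} :
    L.Leaves B₀ B j l ↔ 0 < L.enteringColumn B j l ∧ ∀ r, r ≠ l → 0 < L.enteringColumn B j r →
      L.LexPos ((L.enteringColumn B j r)⁻¹ • L.tableauRow B₀ B r -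
        (L.enteringColumn B j l)⁻¹ • L.tableauRow B₀ B l) := by
  refine and_congr_right fun _ => forall_congr' fun r => forall₂_congr fun _ _ => ?_
  refine or_congr ?_ (and_congr ?_ ?_)
  · simp [tableauRow, div_eq_inv_mul]
  · simp [tableauRow, div_eq_inv_mul, sub_eq_zero, eq_comm]
  · rw [lexLT_iff_sub]
    refine iff_of_eq (congrArg _ (funext fun s => ?_))
    simp [tableauRow, div_eq_inv_mul]

theorem exists_leaves {B₀ B : L.Row → L.Col} (h₀ : L.IsBasis B₀) (h : L.IsBasis B) {j : L.Col}
    (hpos : ∃ r, 0 < L.enteringColumn B j r) : ∃ l, L.Leaves B₀ B j l := by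
  set rat : L.Row → ℝ × (L.Row → ℝ) :=
    fun r => (L.enteringColumn B j r)⁻¹ • L.tableauRow B₀ B r
  let rel : L.Row → L.Row → Prop := fun r s => L.LexPos (rat s - rat r)
  have : IsTrans L.Row rel := ⟨fun r s t h₁ h₂ => by
    have := LexPos.add h₂ h₁
    rwa [sub_add_sub_cancel] at this⟩
  have : Std.Irrefl rel := ⟨fun r (hr : L.LexPos (rat r - rat r)) => by
    rw [sub_self] at hr
    exact not_lexPos_zero hr⟩
  have hwf : WellFounded rel := Finite.wellFounded_of_trans_of_irrefl _
  obtain ⟨l, hl, hmin⟩ := hwf.has_min {r | 0 < L.enteringColumn B j r} hpos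
  refine ⟨l, leaves_iff.2 ⟨hl, fun r hrl hr => ?_⟩⟩
  have hne : (rat r - rat l).2 ≠ 0 := lexTableau_row_ne h₀ h hrl (inv_ne_zero (ne_of_gt hr))
  refine (lexPos_or_neg hne).resolve_right fun hneg => hmin r hr ?_
  rwa [neg_sub] at hneg

theorem tableauRow_update_self {B₀ B : L.Row → L.Col} (hB : L.IsBasis B) {j : L.Col}
    (hj : L.Nonbasic B j) {l : L.Row} (hl : L.enteringColumn B j l ≠ 0) :
    L.tableauRow B₀ (Function.update B l j) l =
      (L.enteringColumn B j l)⁻¹ • L.tableauRow B₀ B l := by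
  refine Prod.ext ?_ (funext fun s => ?_)
  · exact (inv_mulVec_update_self hB hj hl _).trans (div_eq_inv_mul _ _)
  · exact (inv_mulVec_update_self hB hj hl _).trans (div_eq_inv_mul _ _)

theorem tableauRow_update_of_ne {B₀ B : L.Row → L.Col} (hB : L.IsBasis B) {j : L.Col}
    (hj : L.Nonbasic B j) {l r : L.Row} (hl : L.enteringColumn B j l ≠ 0) (hr : r ≠ l) :
    L.tableauRow B₀ (Function.update B l j) r = L.tableauRow B₀ B r -
      L.enteringColumn B j r • ((L.enteringColumn B j l)⁻¹ • L.tableauRow B₀ B l) := by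
  have h : ∀ x y u v : ℝ, x - y / u * v = x - v * (u⁻¹ * y) := fun x y u v => by ring
  refine Prod.ext ?_ (funext fun s => ?_)
  · exact (inv_mulVec_update_of_ne hB hj hl hr _).trans (h _ _ _ _)
  · exact (inv_mulVec_update_of_ne hB hj hl hr _).trans (h _ _ _ _)

theorem IsLexFeasible.update {B₀ B : L.Row → L.Col} (h : L.IsLexFeasible B₀ B) {j : L.Col}
    (hj : L.Nonbasic B j) {l : L.Row} (hl : L.Leaves B₀ B j l) :
    L.IsLexFeasible B₀ (Function.update B l j) := by
  obtain ⟨hul, hmin⟩ := leaves_iff.1 hl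
  refine ⟨h.1.update hj hul.ne', fun r => ?_⟩
  have hT := (h.2 l).smul (inv_pos.2 hul)
  by_cases hr : r = l
  · rw [hr, tableauRow_update_self h.1 hj hul.ne']
    exact hT
  · rw [tableauRow_update_of_ne h.1 hj hul.ne' hr]
    rcases lt_trichotomy (L.enteringColumn B j r) 0 with hu | hu | hu
    · rw [sub_eq_add_neg, ← neg_smul]
      exact (h.2 r).add (hT.smul (neg_pos.2 hu))
    · rw [hu, zero_smul, sub_zero]
      exact h.2 r
    · have := (hmin r hr hu).smul hu
      rwa [smul_sub, smul_inv_smul₀ hu.ne'] at this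

theorem lexValue_update {B₀ B : L.Row → L.Col} (hB : L.IsBasis B) {j : L.Col}
    (hj : L.Nonbasic B j) {l : L.Row} (hl : L.enteringColumn B j l ≠ 0) (g : L.Col → ℝ) :
    L.lexValue B₀ g (Function.update B l j) = L.lexValue B₀ g B +
      (g ⬝ᵥ L.stdDirection B j) • ((L.enteringColumn B j l)⁻¹ • L.tableauRow B₀ B l) := by
  have h : ∀ r ∈ Finset.univ.erase l,
      g (Function.update B l j r) • L.tableauRow B₀ (Function.update B l j) r =
        g (B r) • L.tableauRow B₀ B r - (g (B r) * L.enteringColumn B j r) •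
          ((L.enteringColumn B j l)⁻¹ • L.tableauRow B₀ B l) := by
    intro r hr
    have hr := Finset.ne_of_mem_erase hr
    rw [Function.update_of_ne hr, tableauRow_update_of_ne hB hj hl hr, smul_sub, mul_smul]
  rw [lexValue, ← Finset.add_sum_erase _ _ (Finset.mem_univ l), Finset.sum_congr rfl h,
    Function.update_self, tableauRow_update_self hB hj hl, Finset.sum_sub_distrib,
    ← Finset.sum_smul, lexValue, ← Finset.add_sum_erase _ (fun r => g (B r) • _)
    (Finset.mem_univ l), dotProduct_stdDirection,
    ← Finset.add_sum_erase _ (fun r => g (B r) * _) (Finset.mem_univ l)]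
  have h1 : g (B l) • L.tableauRow B₀ B l = (g (B l) * L.enteringColumn B j l) •
      ((L.enteringColumn B j l)⁻¹ • L.tableauRow B₀ B l) := by
    rw [mul_smul, smul_inv_smul₀ hl]
  rw [h1, sub_smul, add_smul]
  abel

/-- A lexicographic pivot strictly increases every functional that improves along the pivot
direction, degenerate or not. -/
theorem IsLexFeasible.lexValue_lt {B₀ B : L.Row → L.Col} (h : L.IsLexFeasible B₀ B) {j : L.Col}
    (hj : L.Nonbasic B j) {l : L.Row} (hl : L.Leaves B₀ B j l) {g : L.Col → ℝ}
    (hg : 0 < g ⬝ᵥ L.stdDirection B j) :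
    L.LexPos (L.lexValue B₀ g (Function.update B l j) - L.lexValue B₀ g B) := by
  rw [lexValue_update h.1 hj hl.1.ne', add_sub_cancel_left]
  exact ((h.2 l).smul (inv_pos.2 hl.1)).smul hg

/-! ### Basic cones and the shadow pivot rule -/

theorem eq_liftDir {y : L.Col → ℝ} (hy : L.stdA *ᵥ y = 0) :
    L.A *ᵥ (fun i => y (Sum.inl i)) = 0 ∧ y = L.liftDir (fun i => y (Sum.inl i)) := by
  have h : y = Sum.elim (fun i => y (Sum.inl i)) (fun k => y (Sum.inr k)) := by
    ext (i | k) <;> rfl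
  rw [h, stdA_mulVec_elim] at hy
  refine ⟨funext fun r => congrFun hy (Sum.inl r), ?_⟩
  ext (i | k)
  · rfl
  · have := congrFun hy (Sum.inr k)
    simp only [Sum.elim_inr, Pi.zero_apply] at this
    simp only [liftDir, Sum.elim_inr]
    linarith

theorem mem_basicCone_iff {B : L.Row → L.Col} {z : Fin n → ℝ} :
    z ∈ L.basicCone B ↔ L.A *ᵥ z = 0 ∧ ∀ k, L.Nonbasic B k → 0 ≤ L.liftDir z k := by
  refine and_congr_right fun _ => ⟨fun h k hk => ?_, fun h => ⟨fun i hi => ?_, fun k hk => ?_⟩⟩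
  · rcases k with i | k
    · have := h.1 i hk
      rw [D_mulVec_nn] at this
      exact neg_nonpos.1 this
    · exact neg_nonneg.2 (h.2 k hk)
  · rw [D_mulVec_nn]
    exact neg_nonpos.2 (h _ hi)
  · exact neg_nonneg.1 (h _ hk)

/-- The main-phase condition read in the standard form. -/
theorem shadowReady_iff {v : Fin n → ℝ} {B : L.Row → L.Col} :
    L.ShadowReady v B ↔ ∀ y : L.Col → ℝ, L.stdA *ᵥ y = 0 → (∀ k, L.Nonbasic B k → 0 ≤ y k) →
      0 < L.extend L.c ⬝ᵥ y → 0 < L.extend v ⬝ᵥ y := by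
  refine ⟨fun h y hy h0 hc => ?_, fun h z hz hc => ?_⟩
  · rw [extend_dotProduct] at hc ⊢
    obtain ⟨h1, h2⟩ := eq_liftDir hy
    exact h _ (mem_basicCone_iff.2 ⟨h1, fun k hk => h2 ▸ h0 k hk⟩) hc
  · obtain ⟨h1, h2⟩ := mem_basicCone_iff.1 hz
    have := h (L.liftDir z) (stdA_mulVec_liftDir h1) h2
    rw [extend_dotProduct, extend_dotProduct] at this
    exact this hc

/-- At a basis satisfying the main-phase condition, the maximal ratio `λ` of the shadow rule makes
the basis optimal for `c - λ v`: every edge, improving or not, satisfies `cᵀz ≤ λ vᵀz`. -/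
theorem ShadowReady.le_ratio_mul {v : Fin n → ℝ} {B : L.Row → L.Col} (hB : L.IsBasis B)
    (hR : L.ShadowReady v B) {j : L.Col} (hj : L.Nonbasic B j) (hm : L.MainEnters v B j)
    {k : L.Col} (hk : L.Nonbasic B k) :
    L.c ⬝ᵥ L.direction B k ≤
      (L.c ⬝ᵥ L.direction B j) / (v ⬝ᵥ L.direction B j) * (v ⬝ᵥ L.direction B k) := by
  rw [shadowReady_iff] at hR
  have hnn : ∀ i, L.Nonbasic B i → ∀ q, L.Nonbasic B q → 0 ≤ L.stdDirection B i q := by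
    intro i hi q hq
    by_cases h : q = i
    · rw [h, stdDirection_self hi]
      exact zero_le_one
    · rw [stdDirection_of_ne hq h]
  have hpos : ∀ i, L.Nonbasic B i → 0 < L.c ⬝ᵥ L.direction B i → 0 < v ⬝ᵥ L.direction B i := by
    intro i hi hc
    rw [← extend_dotProduct_stdDirection] at hc ⊢
    exact hR _ (hB.stdA_mulVec_stdDirection i) (hnn i hi) hc
  have hvj := hpos j hj hm.1
  by_cases hc : 0 < L.c ⬝ᵥ L.direction B k
  · have := hm.2 k hk hc
    rwa [div_le_iff₀ (hpos k hk hc)] at this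
  · rw [not_lt] at hc
    rcases le_or_gt 0 (v ⬝ᵥ L.direction B k) with hv | hv
    · exact hc.trans (mul_nonneg (div_pos hm.1 hvj).le hv)
    · -- the combination of `zʲ` and `zᵏ` on which `v` vanishes lies in the basic cone
      have h := hR ((-(v ⬝ᵥ L.direction B k)) • L.stdDirection B j +
          (v ⬝ᵥ L.direction B j) • L.stdDirection B k) ?_ ?_
      · simp only [dotProduct_add, dotProduct_smul, extend_dotProduct_stdDirection,
          smul_eq_mul] at h
        have h' : ¬ 0 < -(v ⬝ᵥ L.direction B k) * (v ⬝ᵥ L.direction B j) +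
            (v ⬝ᵥ L.direction B j) * (v ⬝ᵥ L.direction B k) := by
          rw [not_lt]
          exact le_of_eq (by ring)
        have h2 := not_lt.1 (mt h h')
        rw [div_mul_eq_mul_div, le_div_iff₀ hvj]
        linarith
      · rw [mulVec_add, mulVec_smul, mulVec_smul, hB.stdA_mulVec_stdDirection,
          hB.stdA_mulVec_stdDirection, smul_zero, smul_zero, add_zero]
      · intro q hq
        exact add_nonneg (mul_nonneg (neg_pos.2 hv).le (hnn j hj q hq))
          (mul_nonneg hvj.le (hnn k hk q hq))

theorem ShadowReady.dotProduct_pos {v : Fin n → ℝ} {B : L.Row → L.Col} (hB : L.IsBasis B)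
    (hR : L.ShadowReady v B) {j : L.Col} (hj : L.Nonbasic B j)
    (hc : 0 < L.c ⬝ᵥ L.direction B j) : 0 < v ⬝ᵥ L.direction B j := by
  rw [← extend_dotProduct_stdDirection] at hc ⊢
  refine shadowReady_iff.1 hR _ (hB.stdA_mulVec_stdDirection j) (fun q hq => ?_) hc
  by_cases h : q = j
  · rw [h, stdDirection_self hj]
    exact zero_le_one
  · rw [stdDirection_of_ne hq h]

/-- The main-phase condition survives a main-phase pivot: the new basis is still optimal for
`c - λ v`, because the entering variable has reduced cost zero for that objective. -/
theorem ShadowReady.update {v : Fin n → ℝ} {B : L.Row → L.Col} (hB : L.IsBasis B)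
    (hR : L.ShadowReady v B) {j : L.Col} (hj : L.Nonbasic B j) (hm : L.MainEnters v B j)
    (l : L.Row) : L.ShadowReady v (Function.update B l j) := by
  set lam := (L.c ⬝ᵥ L.direction B j) / (v ⬝ᵥ L.direction B j) with hlam
  have hvj := hR.dotProduct_pos hB hj hm.1
  refine shadowReady_iff.2 fun y hy h0 hc => ?_
  have key : L.extend L.c ⬝ᵥ y ≤ lam * (L.extend v ⬝ᵥ y) := by
    rw [dotProduct_eq_sum_stdDirection (B := B) hy, dotProduct_eq_sum_stdDirection (B := B) hy,
      Finset.mul_sum]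
    refine Finset.sum_le_sum fun k _ => ?_
    rw [mul_left_comm]
    by_cases hk : L.Nonbasic B k
    · rw [extend_dotProduct_stdDirection, extend_dotProduct_stdDirection]
      by_cases hkj : k = j
      · rw [hkj, hlam, div_mul_cancel₀ _ hvj.ne']
      · exact mul_le_mul_of_nonneg_left (hR.le_ratio_mul hB hj hm hk)
          (h0 k (nonbasic_update l hk hkj))
    · obtain ⟨r, rfl⟩ := not_not.1 hk
      rw [stdDirection_eq_zero hB]
      simp
  exact pos_of_mul_pos_right (hc.trans_le key) (div_pos hm.1 hvj).le

theorem exists_mainEnters {v : Fin n → ℝ} {B : L.Row → L.Col} (hopt : ¬ L.IsOptimalBasis B) :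
    ∃ j, L.Nonbasic B j ∧ L.MainEnters v B j := by
  simp only [IsOptimalBasis, reducedCost_eq, not_forall, not_le] at hopt
  obtain ⟨j₀, hj₀, hc₀⟩ := hopt
  obtain ⟨j, ⟨hj, hc⟩, hmax⟩ := Set.exists_max_image
    {k | L.Nonbasic B k ∧ 0 < L.c ⬝ᵥ L.direction B k}
    (fun k => (L.c ⬝ᵥ L.direction B k) / (v ⬝ᵥ L.direction B k)) (Set.toFinite _) ⟨j₀, hj₀, hc₀⟩
  exact ⟨j, hj, hc, fun k hk hck => hmax k ⟨hk, hck⟩⟩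

/-- If no pivot direction were admissible in the initial phase, then every nonnegative combination
of pivot directions that improves `c` would improve `v`. -/
theorem exists_initEnters {v : Fin n → ℝ} {B : L.Row → L.Col} (hB : L.IsBasis B)
    (hR : ¬ L.ShadowReady v B) : ∃ j, L.Nonbasic B j ∧ L.InitEnters v B j := by
  by_contra hno
  simp only [InitEnters, not_exists, not_and, not_or, not_le, not_lt] at hno
  refine hR (shadowReady_iff.2 fun y hy h0 hc => ?_)
  rw [dotProduct_eq_sum_stdDirection (B := B) hy] at hc ⊢
  obtain ⟨k, -, hk⟩ := Finset.exists_lt_of_sum_lt (s := Finset.univ) (f := fun _ => (0 : ℝ))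
    (g := fun k => y k * (L.extend L.c ⬝ᵥ L.stdDirection B k)) (by rwa [Finset.sum_const_zero])
  refine Finset.sum_pos' (fun i _ => ?_) ⟨k, Finset.mem_univ k, ?_⟩
  · by_cases hi : L.Nonbasic B i
    · rw [extend_dotProduct_stdDirection]
      exact mul_nonneg (h0 i hi) (hno i hi).2
    · obtain ⟨r, rfl⟩ := not_not.1 hi
      simp [stdDirection_eq_zero hB]
  · by_cases hi : L.Nonbasic B k
    · rw [extend_dotProduct_stdDirection] at hk ⊢
      have hyk : 0 < y k := (h0 k hi).lt_of_ne fun h => by simp [← h] at hk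
      exact mul_pos hyk ((hno k hi).1 (pos_of_mul_pos_right hk hyk.le))
    · obtain ⟨r, rfl⟩ := not_not.1 hi
      simp [stdDirection_eq_zero hB] at hk

theorem IsFeasibleBasis.isOptimalSolution {B : L.Row → L.Col} (hB : L.IsFeasibleBasis B)
    (hopt : L.IsOptimalBasis B) : L.IsOptimalSolution (L.vertex B) := by
  refine ⟨hB.vertex_mem, fun x hx => ?_⟩
  obtain ⟨hxA, hx0⟩ := mem_feasible_iff.1 hx
  have hker : L.stdA *ᵥ (L.lift x - L.basicSolution B) = 0 := by
    rw [mulVec_sub, stdA_mulVec_lift hxA, hB.1.stdA_mulVec_basicSolution, sub_self]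
  have h1 := dotProduct_eq_sum_stdDirection (B := B) hker (L.extend L.c)
  have h2 : L.extend L.c ⬝ᵥ (L.lift x - L.basicSolution B) =
      L.c ⬝ᵥ x - L.c ⬝ᵥ L.vertex B := by
    rw [dotProduct_sub, extend_dotProduct, extend_dotProduct]
    rfl
  rw [← sub_nonpos, ← h2, h1]
  refine Finset.sum_nonpos fun k _ => ?_
  by_cases hk : L.Nonbasic B k
  · rw [extend_dotProduct_stdDirection, ← reducedCost_eq]
    refine mul_nonpos_of_nonneg_of_nonpos ?_ (hopt k hk)
    have : L.basicSolution B k = 0 := embed_nonbasic hk _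
    rw [Pi.sub_apply, this, sub_zero]
    exact hx0 k
  · obtain ⟨r, rfl⟩ := not_not.1 hk
    simp [stdDirection_eq_zero hB.1]

/-! ### Steps in the polytope -/

/-- In a bounded polyhedron every pivot direction is blocked by some basic variable. -/
theorem IsFeasibleBasis.exists_enteringColumn_pos {B : L.Row → L.Col}
    (hbd : Bornology.IsBounded L.feasible) (hB : L.IsFeasibleBasis B) {j : L.Col}
    (hj : L.Nonbasic B j) : ∃ r, 0 < L.enteringColumn B j r := by
  by_contra hno
  simp only [not_exists, not_lt] at hno
  have hray : ∀ t : ℝ, 0 ≤ t → L.vertex B + t • L.direction B j ∈ L.feasible := by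
    intro t ht
    have hy : L.stdA *ᵥ (L.basicSolution B + t • L.stdDirection B j) = L.stdb := by
      rw [mulVec_add, mulVec_smul, hB.1.stdA_mulVec_stdDirection, smul_zero, add_zero,
        hB.1.stdA_mulVec_basicSolution]
    refine mem_feasible_of_std hy fun k => add_nonneg (hB.2 k) (mul_nonneg ht ?_)
    by_cases hk : L.Nonbasic B k
    · by_cases hkj : k = j
      · rw [hkj, stdDirection_self hj]
        exact zero_le_one
      · rw [stdDirection_of_ne hk hkj]
    · obtain ⟨r, rfl⟩ := not_not.1 hk
      rw [stdDirection_basic hB.1.injective hj]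
      exact neg_nonneg.2 (hno r)
  obtain ⟨C, hC⟩ := hbd.exists_norm_le
  have hd : 0 < ‖L.direction B j‖ := norm_pos_iff.2 (hB.1.direction_ne_zero hj)
  have hC0 : 0 ≤ C := (norm_nonneg _).trans (hC _ hB.vertex_mem)
  have ht : 0 ≤ (2 * C + 1) / ‖L.direction B j‖ := by positivity
  have h1 := hC _ (hray _ ht)
  have h2 := norm_sub_le (L.vertex B + ((2 * C + 1) / ‖L.direction B j‖) • L.direction B j)
    (L.vertex B)
  rw [add_sub_cancel_left, norm_smul, Real.norm_of_nonneg ht, div_mul_cancel₀ _ hd.ne'] at h2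
  have := hC _ hB.vertex_mem
  linarith

theorem vertex_update {B : L.Row → L.Col} (hB : L.IsBasis B) {j : L.Col} (hj : L.Nonbasic B j)
    {l : L.Row} (hl : L.enteringColumn B j l ≠ 0) :
    L.vertex (Function.update B l j) = L.vertex B +
      (L.basicValue B l / L.enteringColumn B j l) • L.direction B j :=
  funext fun i => congrFun (embed_update hB hj hl L.stdb) (Sum.inl i)

/-- A pivot is non-degenerate exactly if its step length is positive. -/
theorem IsLexFeasible.nondegenerate_iff {B₀ B : L.Row → L.Col} (h : L.IsLexFeasible B₀ B)
    {j : L.Col} (hj : L.Nonbasic B j) {l : L.Row} (hl : L.Leaves B₀ B j l) :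
    L.Nondegenerate B j ↔ 0 < L.basicValue B l / L.enteringColumn B j l := by
  refine ⟨fun ⟨ε, hε, hmem⟩ => ?_, fun hpos => ⟨_, hpos, ?_⟩⟩
  · have h1 := (mem_feasible_iff.1 hmem).2 (B l)
    rw [h.1.lift_vertex_add, Pi.add_apply, Pi.smul_apply, stdDirection_basic h.1.injective hj,
      smul_eq_mul] at h1
    have h2 : L.basicSolution B (B l) = L.basicValue B l := embed_apply h.1.injective _ l
    refine div_pos ?_ hl.1
    have := mul_pos hε hl.1
    linarith
  · rw [← vertex_update h.1 hj hl.1.ne']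
    exact (h.update hj hl).isFeasibleBasis.vertex_mem

theorem IsLexFeasible.step_nonneg {B₀ B : L.Row → L.Col} (h : L.IsLexFeasible B₀ B)
    {j : L.Col} {l : L.Row} (hl : L.Leaves B₀ B j l) :
    0 ≤ L.basicValue B l / L.enteringColumn B j l :=
  div_nonneg (h.2 l).fst_nonneg hl.1.le

/-! ### The slim vector on a 0/1 polytope -/

theorem convex_feasible : Convex ℝ L.feasible := by
  rintro x ⟨hxA, hxD⟩ y ⟨hyA, hyD⟩ a b ha hb hab
  refine ⟨?_, fun k => ?_⟩
  · rw [mulVec_add, mulVec_smul, mulVec_smul, hxA, hyA, ← add_smul, hab, one_smul]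
  · rw [mulVec_add, mulVec_smul, mulVec_smul]
    have h1 := mul_le_mul_of_nonneg_left (hxD k) ha
    have h2 := mul_le_mul_of_nonneg_left (hyD k) hb
    have h3 : a * L.d k + b * L.d k = L.d k := by rw [← add_mul, hab, one_mul]
    simp only [Pi.add_apply, Pi.smul_apply, smul_eq_mul]
    linarith

theorem isClosed_feasible : IsClosed L.feasible :=
  (isClosed_eq (continuous_const.matrix_mulVec continuous_id) continuous_const).inter
    (isClosed_le (continuous_const.matrix_mulVec continuous_id) continuous_const)

/-- By the Krein–Milman theorem a 0/1 polytope lies in the unit cube. -/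
theorem IsZeroOne.feasible_subset (hL : L.IsZeroOne) : L.feasible ⊆ Set.Icc 0 1 := by
  rw [← closure_convexHull_extremePoints
    (Metric.isCompact_of_isClosed_isBounded isClosed_feasible hL.bounded) convex_feasible]
  refine closure_minimal (convexHull_min (fun x hx => ?_) (convex_Icc _ _)) isClosed_Icc
  constructor <;> intro i <;> rcases hL.zero_one x hx i with h | h <;> simp [h]

theorem slimVector_dotProduct_lt {x₀ x : Fin n → ℝ} (h₀ : ∀ i, x₀ i = 0 ∨ x₀ i = 1)
    (hx : x ∈ Set.Icc 0 1) (hne : x ≠ x₀) : slimVector x₀ ⬝ᵥ x₀ < slimVector x₀ ⬝ᵥ x := by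
  have hle : ∀ i, slimVector x₀ i * x₀ i ≤ slimVector x₀ i * x i := fun i => by
    have h1 : 0 ≤ x i := hx.1 i
    have h2 : x i ≤ 1 := hx.2 i
    rcases h₀ i with h | h <;> rw [slimVector, h] <;> linarith
  obtain ⟨i, hi⟩ := Function.ne_iff.1 hne
  refine Finset.sum_lt_sum (fun i _ => hle i) ⟨i, Finset.mem_univ i, (hle i).lt_of_ne ?_⟩
  intro h
  have hv : slimVector x₀ i ≠ 0 := by
    rcases h₀ i with h | h <;> rw [slimVector, h] <;> norm_num
  exact hi (mul_left_cancel₀ hv h).symm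

/-- On 0/1 points the slim vector measures the Hamming distance to its base point. -/
theorem slimVector_dotProduct_eq {x₀ x : Fin n → ℝ} (h₀ : ∀ i, x₀ i = 0 ∨ x₀ i = 1)
    (hx : ∀ i, x i = 0 ∨ x i = 1) :
    slimVector x₀ ⬝ᵥ x = slimVector x₀ ⬝ᵥ x₀ + (hammingDist x x₀ : ℝ) := by
  have h : (hammingDist x x₀ : ℝ) = ∑ i, if x i ≠ x₀ i then 1 else 0 := by
    rw [hammingDist, Finset.card_filter, Nat.cast_sum]
    simp only [Nat.cast_ite, Nat.cast_one, Nat.cast_zero]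
  rw [h, dotProduct, dotProduct, ← Finset.sum_add_distrib]
  refine Finset.sum_congr rfl fun i _ => ?_
  rcases h₀ i with h | h <;> rcases hx i with h' | h' <;> rw [slimVector, h, h'] <;> norm_num

theorem IsZeroOne.vertex_zero_one (hL : L.IsZeroOne) {B : L.Row → L.Col}
    (hB : L.IsFeasibleBasis B) (i : Fin n) : L.vertex B i = 0 ∨ L.vertex B i = 1 :=
  hL.zero_one _ hB.vertex_mem_extremePoints i

/-- Pivots of the initial phase taken at the initial vertex are degenerate, because this vertex is
the unique minimizer of the slim vector over the polytope. -/
theorem InitEnters.not_nondegenerate (hL : L.IsZeroOne) {B : L.Row → L.Col}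
    (hB : L.IsFeasibleBasis B) {j : L.Col} (hj : L.Nonbasic B j)
    (hi : L.InitEnters (slimVector (L.vertex B)) B j) : ¬ L.Nondegenerate B j := by
  rintro ⟨ε, hε, hmem⟩
  have h := slimVector_dotProduct_lt (hL.vertex_zero_one hB) (hL.feasible_subset hmem)
    (by simpa [hε.ne'] using hB.1.direction_ne_zero hj)
  rw [dotProduct_add, dotProduct_smul, lt_add_iff_pos_right, smul_eq_mul] at h
  have h' := pos_of_mul_pos_right h hε.le
  rcases hi with hi | hi
  · exact h'.not_ge hi.2
  · exact h'.not_gt hi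

/-! ### Executions -/

variable {B₀ : L.Row → L.Col} {T : ℕ} {B : ℕ → L.Row → L.Col} {j : ℕ → L.Col} {l : ℕ → L.Row}

theorem IsSlimShadowRun.isLexFeasible (h : L.IsSlimShadowRun B₀ T B j l)
    (hB₀ : L.IsFeasibleBasis B₀) {t : ℕ} (ht : t ≤ T) : L.IsLexFeasible B₀ (B t) := by
  induction t with
  | zero =>
    rw [h.start]
    exact hB₀.isLexFeasible_self
  | succ t ih =>
    obtain ⟨-, hj, -, -, hl⟩ := h.pivot t ht
    rw [h.next t ht]
    exact (ih (Nat.le_of_succ_le ht)).update hj hl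

theorem IsSlimShadowRun.shadowReady_mono (h : L.IsSlimShadowRun B₀ T B j l)
    (hB₀ : L.IsFeasibleBasis B₀) {s t : ℕ} (hst : s ≤ t) (ht : t ≤ T)
    (hs : L.ShadowReady (slimVector (L.vertex B₀)) (B s)) :
    L.ShadowReady (slimVector (L.vertex B₀)) (B t) := by
  induction t, hst using Nat.le_induction with
  | base => exact hs
  | succ t _ ih =>
    have hR := ih (Nat.le_of_succ_le ht)
    obtain ⟨-, hj, hm, -, -⟩ := h.pivot t ht
    rw [h.next t ht]
    exact hR.update (h.isLexFeasible hB₀ (Nat.le_of_succ_le ht)).1 hj (hm hR) _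

theorem IsSlimShadowRun.vertex_succ (h : L.IsSlimShadowRun B₀ T B j l)
    (hB₀ : L.IsFeasibleBasis B₀) {t : ℕ} (ht : t < T) :
    L.vertex (B (t + 1)) = L.vertex (B t) +
      (L.basicValue (B t) (l t) / L.enteringColumn (B t) (j t) (l t)) •
        L.direction (B t) (j t) := by
  obtain ⟨-, hj, -, -, hl⟩ := h.pivot t ht
  rw [h.next t ht, vertex_update (h.isLexFeasible hB₀ ht.le).1 hj hl.1.ne']

/-- The initial vertex is not left before the main phase begins. -/
theorem IsSlimShadowRun.vertex_eq (h : L.IsSlimShadowRun B₀ T B j l) (hL : L.IsZeroOne)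
    (hB₀ : L.IsFeasibleBasis B₀) {t : ℕ} (ht : t ≤ T)
    (hR : ¬ L.ShadowReady (slimVector (L.vertex B₀)) (B t)) : L.vertex (B t) = L.vertex B₀ := by
  induction t with
  | zero => rw [h.start]
  | succ t ih =>
    have hR' := mt (h.shadowReady_mono hB₀ t.le_succ ht) hR
    have hx := ih (Nat.le_of_succ_le ht) hR'
    have hf := h.isLexFeasible hB₀ (Nat.le_of_succ_le ht)
    obtain ⟨-, hj, -, hi, hl⟩ := h.pivot t ht
    have hi := hi hR'
    rw [← hx] at hi
    have hdeg := hi.not_nondegenerate hL hf.isFeasibleBasis hj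
    rw [hf.nondegenerate_iff hj hl] at hdeg
    rw [h.vertex_succ hB₀ ht, le_antisymm (not_lt.1 hdeg) (hf.step_nonneg hl), zero_smul,
      add_zero, hx]

theorem IsSlimShadowRun.not_nondegenerate (h : L.IsSlimShadowRun B₀ T B j l) (hL : L.IsZeroOne)
    (hB₀ : L.IsFeasibleBasis B₀) {t : ℕ} (ht : t < T)
    (hR : ¬ L.ShadowReady (slimVector (L.vertex B₀)) (B t)) :
    ¬ L.Nondegenerate (B t) (j t) := by
  obtain ⟨-, hj, -, hi, -⟩ := h.pivot t ht
  have hi := hi hR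
  rw [← h.vertex_eq hL hB₀ ht.le hR] at hi
  exact hi.not_nondegenerate hL (h.isLexFeasible hB₀ ht.le).isFeasibleBasis hj

/-- The distance from the initial vertex never decreases, and grows at non-degenerate pivots. -/
theorem IsSlimShadowRun.hammingDist_succ (h : L.IsSlimShadowRun B₀ T B j l) (hL : L.IsZeroOne)
    (hB₀ : L.IsFeasibleBasis B₀) {t : ℕ} (ht : t < T) :
    hammingDist (L.vertex (B t)) (L.vertex B₀) ≤
      hammingDist (L.vertex (B (t + 1))) (L.vertex B₀) ∧
    (L.Nondegenerate (B t) (j t) → hammingDist (L.vertex (B t)) (L.vertex B₀) <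
      hammingDist (L.vertex (B (t + 1))) (L.vertex B₀)) := by
  have hf := h.isLexFeasible hB₀ ht.le
  obtain ⟨-, hj, hm, -, hl⟩ := h.pivot t ht
  have hv := h.vertex_succ hB₀ ht
  by_cases hnd : L.Nondegenerate (B t) (j t)
  · have hR := not_not.1 (mt (h.not_nondegenerate hL hB₀ ht) (not_not.2 hnd))
    have hpos := mul_pos ((hf.nondegenerate_iff hj hl).1 hnd)
      (hR.dotProduct_pos hf.1 hj (hm hR).1)
    have h1 := slimVector_dotProduct_eq (hL.vertex_zero_one hB₀)
      (hL.vertex_zero_one hf.isFeasibleBasis)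
    have h2 := slimVector_dotProduct_eq (hL.vertex_zero_one hB₀)
      (hL.vertex_zero_one (h.isLexFeasible hB₀ (Nat.succ_le_of_lt ht)).isFeasibleBasis)
    rw [Nat.succ_eq_add_one, hv, dotProduct_add, dotProduct_smul, smul_eq_mul, ← hv] at h2
    have h3 : (hammingDist (L.vertex (B t)) (L.vertex B₀) : ℝ) <
        hammingDist (L.vertex (B (t + 1))) (L.vertex B₀) := by linarith
    have h4 := Nat.cast_lt.1 h3
    exact ⟨h4.le, fun _ => h4⟩
  · have h0 := hnd
    rw [hf.nondegenerate_iff hj hl] at h0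
    rw [hv, le_antisymm (not_lt.1 h0) (hf.step_nonneg hl), zero_smul, add_zero]
    exact ⟨le_rfl, fun h => absurd h hnd⟩

theorem IsSlimShadowRun.ncard_nondegenerate_le (h : L.IsSlimShadowRun B₀ T B j l)
    (hL : L.IsZeroOne) (hB₀ : L.IsFeasibleBasis B₀) :
    {t : ℕ | t < T ∧ L.Nondegenerate (B t) (j t)}.ncard ≤ n := by
  set f : ℕ → ℕ := fun t => hammingDist (L.vertex (B t)) (L.vertex B₀) with hf
  have hmono : ∀ s t, s ≤ t → t ≤ T → f s ≤ f t := by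
    intro s t hst ht
    induction t, hst using Nat.le_induction with
    | base => exact le_rfl
    | succ t _ ih => exact (ih (Nat.le_of_succ_le ht)).trans (h.hammingDist_succ hL hB₀ ht).1
  have hlt : ∀ s t, s < t → t ≤ T → L.Nondegenerate (B s) (j s) → f s < f t :=
    fun s t hst ht hs => ((h.hammingDist_succ hL hB₀ (hst.trans_le ht)).2 hs).trans_le
      (hmono _ _ hst ht)
  have hcard : (Set.Iio n).ncard = n := by
    rw [← Finset.coe_Iio, Set.ncard_coe_finset, Nat.card_Iio]
  refine (Set.ncard_le_ncard_of_injOn f ?_ ?_ (Set.finite_Iio n)).trans_eq hcard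
  · rintro t ⟨ht, hnd⟩
    refine (hlt t T ht le_rfl hnd).trans_le ?_
    simpa using (hammingDist_le_card_fintype (x := L.vertex (B T)) (y := L.vertex B₀))
  · rintro s ⟨hs, hs'⟩ t ⟨ht, ht'⟩ hst
    rcases lt_trichotomy s t with h1 | h1 | h1
    · exact absurd hst (hlt s t h1 ht.le hs').ne
    · exact h1
    · exact absurd hst (hlt t s h1 hs.le ht').ne'

/-- No basis is repeated along a stretch of pivots that all improve one fixed functional. -/
theorem IsSlimShadowRun.ne_of_improving (h : L.IsSlimShadowRun B₀ T B j l)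
    (hB₀ : L.IsFeasibleBasis B₀) (g : L.Col → ℝ) {s t : ℕ} (hst : s < t) (ht : t ≤ T)
    (hg : ∀ q, s ≤ q → q < t → 0 < g ⬝ᵥ L.stdDirection (B q) (j q)) : B s ≠ B t := by
  have hstep : ∀ q, s ≤ q → q < t →
      L.LexPos (L.lexValue B₀ g (B (q + 1)) - L.lexValue B₀ g (B q)) := by
    intro q hsq hqt
    obtain ⟨-, hj, -, -, hl⟩ := h.pivot q (hqt.trans_le ht)
    rw [h.next q (hqt.trans_le ht)]
    exact (h.isLexFeasible hB₀ (hqt.le.trans ht)).lexValue_lt hj hl (hg q hsq hqt)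
  have hpos : ∀ q, s + 1 ≤ q → q ≤ t →
      L.LexPos (L.lexValue B₀ g (B q) - L.lexValue B₀ g (B s)) := by
    intro q hsq
    induction q, hsq using Nat.le_induction with
    | base => exact fun hq => hstep s le_rfl hq
    | succ q hsq ih =>
      intro hq
      have := (hstep q (Nat.le_of_succ_le hsq) hq).add (ih (Nat.le_of_succ_le hq))
      rwa [sub_add_sub_cancel] at this
  intro heq
  have := hpos t hst le_rfl
  rw [heq, sub_self] at this
  exact not_lexPos_zero this

/-- For a large multiple `M`, the functional `c - M v` improves along every direction admissible in
the initial phase. -/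
theorem exists_initEnters_improving (L : LinProg m p n) (v : Fin n → ℝ) :
    ∃ M : ℝ, ∀ (B : L.Row → L.Col) (j : L.Col), L.InitEnters v B j →
      0 < L.extend (L.c - M • v) ⬝ᵥ L.stdDirection B j := by
  refine ⟨1 + ∑ q : (L.Row → L.Col) × L.Col,
    |(L.c ⬝ᵥ L.direction q.1 q.2) / (v ⬝ᵥ L.direction q.1 q.2)|, fun B j hi => ?_⟩
  have hM := Finset.single_le_sum (f := fun q : (L.Row → L.Col) × L.Col =>
    |(L.c ⬝ᵥ L.direction q.1 q.2) / (v ⬝ᵥ L.direction q.1 q.2)|) (fun q _ => abs_nonneg _)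
    (Finset.mem_univ (B, j))
  set S := ∑ q : (L.Row → L.Col) × L.Col,
    |(L.c ⬝ᵥ L.direction q.1 q.2) / (v ⬝ᵥ L.direction q.1 q.2)|
  rw [extend_dotProduct_stdDirection, sub_dotProduct, smul_dotProduct, smul_eq_mul]
  have hS : 0 ≤ S := (abs_nonneg _).trans hM
  rcases lt_or_ge (v ⬝ᵥ L.direction B j) 0 with hv | hv
  · have h1 : (L.c ⬝ᵥ L.direction B j) / (v ⬝ᵥ L.direction B j) < 1 + S := by
      have := (le_abs_self _).trans hM
      linarith
    rw [div_lt_iff_of_neg hv] at h1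
    linarith
  · rcases hi with hi | hi
    · rw [le_antisymm hi.2 hv, mul_zero, sub_zero]
      exact hi.1
    · exact absurd hi hv.not_gt

/-- Each of the two phases visits every basis at most once. -/
theorem IsSlimShadowRun.length_le (h : L.IsSlimShadowRun B₀ T B j l)
    (hB₀ : L.IsFeasibleBasis B₀) : T ≤ 2 * Fintype.card (L.Row → L.Col) := by
  classical
  set v := slimVector (L.vertex B₀) with hv
  obtain ⟨M, hM⟩ := exists_initEnters_improving L v
  have hinj : ∀ S : Finset ℕ,
      (∀ s ∈ S, ∀ t ∈ S, s < t → B s ≠ B t) → S.card ≤ Fintype.card (L.Row → L.Col) := by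
    intro S hS
    refine Finset.card_le_card_of_injOn B (fun _ _ => Finset.mem_univ _) fun s hs t ht hst => ?_
    rcases lt_trichotomy s t with h1 | h1 | h1
    · exact absurd hst (hS s hs t ht h1)
    · exact h1
    · exact absurd hst.symm (hS t ht s hs h1)
  have hmain := hinj ((Finset.range T).filter fun t => L.ShadowReady v (B t)) (by
    intro s hs t ht hst
    rw [Finset.mem_filter, Finset.mem_range] at hs ht
    refine h.ne_of_improving hB₀ (L.extend L.c) hst ht.1.le fun q hsq hqt => ?_
    have hq : q < T := hqt.trans ht.1
    rw [extend_dotProduct_stdDirection]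
    exact ((h.pivot q hq).2.2.1 (h.shadowReady_mono hB₀ hsq hq.le hs.2)).1)
  have hinit := hinj ((Finset.range T).filter fun t => ¬ L.ShadowReady v (B t)) (by
    intro s hs t ht hst
    rw [Finset.mem_filter, Finset.mem_range] at hs ht
    refine h.ne_of_improving hB₀ (L.extend (L.c - M • v)) hst ht.1.le fun q hsq hqt => ?_
    have hq : q < T := hqt.trans ht.1
    exact hM _ _ ((h.pivot q hq).2.2.2.1 (mt (h.shadowReady_mono hB₀ hqt.le ht.1.le) ht.2)))
  have := Finset.card_filter_add_card_filter_not (s := Finset.range T)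
    (fun t => L.ShadowReady v (B t))
  rw [Finset.card_range] at this
  omega

theorem exists_slimShadowPivot (hL : L.IsZeroOne) (hB₀ : L.IsFeasibleBasis B₀)
    {B : L.Row → L.Col} (hB : L.IsFeasibleBasis B) (hopt : ¬ L.IsOptimalBasis B) :
    ∃ j l, L.SlimShadowPivot B₀ B j l := by
  have hleave : ∀ {j}, L.Nonbasic B j → ∃ l, L.Leaves B₀ B j l := fun hj =>
    exists_leaves hB₀.1 hB.1 (hB.exists_enteringColumn_pos hL.bounded hj)
  by_cases hR : L.ShadowReady (slimVector (L.vertex B₀)) B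
  · obtain ⟨j, hj, hm⟩ := exists_mainEnters (v := slimVector (L.vertex B₀)) hopt
    obtain ⟨l, hl⟩ := hleave hj
    exact ⟨j, l, hopt, hj, fun _ => hm, fun h => absurd hR h, hl⟩
  · obtain ⟨j, hj, hi⟩ := exists_initEnters hB.1 hR
    obtain ⟨l, hl⟩ := hleave hj
    exact ⟨j, l, hopt, hj, fun h => absurd h hR, fun _ => hi, hl⟩

end LinProg

end

theorem mainTheorem2 {m p n : ℕ} (L : LinProg m p n) (hL : L.IsZeroOne)
    (B₀ : L.Row → L.Col) (hB₀ : L.IsFeasibleBasis B₀) :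
    -- every execution terminates
    (∃ N : ℕ, ∀ (T : ℕ) (B : ℕ → L.Row → L.Col) (j : ℕ → L.Col) (l : ℕ → L.Row),
      L.IsSlimShadowRun B₀ T B j l → T ≤ N) ∧
    ∀ (T : ℕ) (B : ℕ → L.Row → L.Col) (j : ℕ → L.Col) (l : ℕ → L.Row),
      L.IsSlimShadowRun B₀ T B j l →
        -- only feasible bases are visited
        L.IsFeasibleBasis (B T) ∧
        -- an execution that cannot be continued has reached an optimal solution
        ((¬ ∃ (j' : L.Col) (l' : L.Row), L.SlimShadowPivot B₀ (B T) j' l') →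
          L.IsOptimalBasis (B T) ∧ L.IsOptimalSolution (L.vertex (B T))) ∧
        -- pivots of the initial phase are degenerate
        (∀ t < T, ¬ L.ShadowReady (LinProg.slimVector (L.vertex B₀)) (B t) →
          ¬ L.Nondegenerate (B t) (j t)) ∧
        -- at most `n` pivots are non-degenerate
        {t : ℕ | t < T ∧ L.Nondegenerate (B t) (j t)}.ncard ≤ n := by
  refine ⟨⟨2 * Fintype.card (L.Row → L.Col), fun T B j l h => h.length_le hB₀⟩,
    fun T B j l h => ?_⟩
  have hf := (h.isLexFeasible hB₀ le_rfl).isFeasibleBasis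
  refine ⟨hf, fun hend => ?_, fun t ht hR => h.not_nondegenerate hL hB₀ ht hR,
    h.ncard_nondegenerate_le hL hB₀⟩
  have hopt : L.IsOptimalBasis (B T) := by
    by_contra hopt
    exact hend (LinProg.exists_slimShadowPivot hL hB₀ hf hopt)
  exact ⟨hopt, hf.isOptimalSolution hopt⟩
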